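/- Let $\mathbb{D}=\{z\in\mathbb{C}:|z|<1\}$. A *Loewner chain* is a family $(f_t)_{t\ge 0}$ of univalent (holomorphic and injective) functions $f_t:\mathbb{D}\to\mathbb{C}$ such that $f_s(\mathbb{D})\subseteq f_t(\mathbb{D})$ for all $0\le s<t<\infty$, and such that for every compact set $K\subset\mathbb{D}$ and every $T>0$ there is a non-negative integrable function $k_{K,T}:[0,T]\to\mathbb{R}$ with $|f_s(z)-f_t(z)|\le\int_s^t k_{K,T}(u)\,du$ for all $z\in K$ and $0\le s\le t\le T$. Its transition maps are the holomorphic self-maps $\varphi_{s,t}:=f_t^{-1}\circ f_s$ of $\mathbb{D}$, $0\le s\le t$. A *Herglotz function* is a function $p:\mathbb{D}\times[0,\infty)\to\mathbb{C}$ such that $p(z,\cdot)$ is locally integrable on $[0,\infty)$ for every $z\in\mathbb{D}$, $p(\cdot,t)$ is holomorphic on $\mathbb{D}$ for every $t\ge 0$, and $\operatorname{Re}p(z,t)\ge 0$ for all $z\in\mathbb{D}$, $t\ge 0$. Given a measurable function $\tau:[0,\infty)\to\overline{\mathbb{D}}$ and a Herglotz function $p$, the pair $(p,\tau)$ is *the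 Berkson–Porta data associated with* $(f_t)$ if for all $s\ge 0$ and $z\in\mathbb{D}$ $$\frac{d}{dt}\varphi_{s,t}(z)=\bigl(\varphi_{s,t}(z)-\tau(t)\bigr)\bigl(\overline{\tau(t)}\,\varphi_{s,t}(z)-1\bigr)\,p\bigl(\varphi_{s,t}(z),t\bigr)\qquad\text{for almost every } t\ge s .$$ **Lemma.** Let $(f_t)$ be a Loewner chain and let $(p,\tau)$ be Berkson–Porta data associated with $(f_t)$. Suppose that $\tau\in\overline{\mathbb{D}}$ is constant, and that there are constants $C_1,C_2>0$ such that for every $z\in\mathbb{D}$, $$C_1<\operatorname{Re}p(z,t)<C_2\qquad\text{for almost every } t\in[0,\infty).$$ Then the Loewner range is the whole plane: $\bigcup_{t\ge 0}f_t(\mathbb{D})=\mathbb{C}$. -/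

import Mathlib

open Set MeasureTheory
open scoped ComplexConjugate

/-- A (generalized) Loewner chain `(f_t)`, `t ≥ 0`, on the unit disk. Values of `f` at negative times
or at points outside the unit disk are irrelevant. -/
structure IsLoewnerChain (f : ℝ → ℂ → ℂ) : Prop where
  holomorphic : ∀ t : ℝ, 0 ≤ t → DifferentiableOn ℂ (f t) (Metric.ball 0 1)
  injective : ∀ t : ℝ, 0 ≤ t → InjOn (f t) (Metric.ball 0 1)
  monotone : ∀ s t : ℝ, 0 ≤ s → s < t → f s '' Metric.ball 0 1 ⊆ f t '' Metric.ball 0 1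
  regular : ∀ K : Set ℂ, IsCompact K → K ⊆ Metric.ball 0 1 → ∀ T : ℝ, 0 < T →
    ∃ k : ℝ → ℝ, (∀ u ∈ Icc 0 T, 0 ≤ k u) ∧ IntegrableOn k (Icc 0 T) ∧
      ∀ z ∈ K, ∀ s t : ℝ, 0 ≤ s → s ≤ t → t ≤ T → ‖f s z - f t z‖ ≤ ∫ u in s..t, k u

/-- The transition maps `φ_{s,t} = f_t⁻¹ ∘ f_s` of a Loewner chain, where `f_t⁻¹` is the inverse of
`f_t` on the unit disk. It is meaningful for `0 ≤ s ≤ t` and arguments in the unit disk, where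
`f_s(𝔻) ⊆ f_t(𝔻)`. -/
noncomputable def transitionMap (f : ℝ → ℂ → ℂ) (s t : ℝ) (z : ℂ) : ℂ :=
  Function.invFunOn (f t) (Metric.ball 0 1) (f s z)

/-- The transition maps are characterized by `φ_{s,t}(z) ∈ 𝔻` and `f_t(φ_{s,t}(z)) = f_s(z)`. -/
theorem IsLoewnerChain.transitionMap_eq_iff {f : ℝ → ℂ → ℂ} (hf : IsLoewnerChain f) {s t : ℝ}
    (hs : 0 ≤ s) (hst : s ≤ t) {z w : ℂ} (hz : z ∈ Metric.ball (0 : ℂ) 1) :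
    transitionMap f s t z = w ↔ w ∈ Metric.ball (0 : ℂ) 1 ∧ f t w = f s z := by
  have hmem : f s z ∈ f t '' Metric.ball 0 1 := by
    rcases hst.eq_or_lt with rfl | h
    · exact ⟨z, hz, rfl⟩
    · exact hf.monotone s t hs h ⟨z, hz, rfl⟩
  have h1 := Function.invFunOn_mem hmem
  have h2 := Function.invFunOn_eq hmem
  constructor
  · rintro rfl
    exact ⟨h1, h2⟩
  · rintro ⟨hw, hfw⟩
    exact hf.injective t (hs.trans hst) h1 hw (h2.trans hfw.symm)

/-- A Herglotz function `p(z, t)` on the unit disk, `t ≥ 0`. -/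
structure IsHerglotzFunction (p : ℂ → ℝ → ℂ) : Prop where
  locallyIntegrable : ∀ z ∈ Metric.ball (0 : ℂ) 1, LocallyIntegrableOn (fun t => p z t) (Ici 0)
  holomorphic : ∀ t : ℝ, 0 ≤ t → DifferentiableOn ℂ (fun z => p z t) (Metric.ball 0 1)
  re_nonneg : ∀ z ∈ Metric.ball (0 : ℂ) 1, ∀ t : ℝ, 0 ≤ t → 0 ≤ (p z t).re

/-- A Denjoy-Wolff function: a measurable function from `[0, ∞)` to the closed unit disk. -/
structure IsDenjoyWolffFunction (τ : ℝ → ℂ) : Prop where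
  measurable : Measurable (fun t : Ici (0 : ℝ) => τ t)
  mem_closedBall : ∀ t : ℝ, 0 ≤ t → τ t ∈ Metric.closedBall (0 : ℂ) 1

/-- `(p, τ)` is the Berkson-Porta data associated with the Loewner chain `(f_t)`, that is, with its
transition maps `φ_{s,t} = f_t⁻¹ ∘ f_s`: `p` is a Herglotz function, `τ` is a Denjoy-Wolff function,
and for all `s ≥ 0` and `z ∈ 𝔻`,
`d/dt φ_{s,t}(z) = (φ_{s,t}(z) - τ(t)) (conj τ(t) φ_{s,t}(z) - 1) p(φ_{s,t}(z), t)`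
for almost every `t ≥ s`. -/
structure IsBerksonPortaData (f : ℝ → ℂ → ℂ) (p : ℂ → ℝ → ℂ) (τ : ℝ → ℂ) : Prop where
  herglotz : IsHerglotzFunction p
  denjoyWolff : IsDenjoyWolffFunction τ
  ode : ∀ s : ℝ, 0 ≤ s → ∀ z ∈ Metric.ball (0 : ℂ) 1, ∀ᵐ t : ℝ, s < t →
    HasDerivAt (fun r : ℝ => transitionMap f s r z)
      ((transitionMap f s t z - τ t) * (conj (τ t) * transitionMap f s t z - 1) *
        p (transitionMap f s t z) t) t

/-- The Loewner range `⋃_{t ≥ 0} f_t(𝔻)`. -/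
def loewnerRange (f : ℝ → ℂ → ℂ) : Set ℂ :=
  ⋃ t ∈ Ici (0 : ℝ), f t '' Metric.ball 0 1

/-!
Suppose the Loewner range omits a point `w₀`, and let `a_t`, `b_t` be the orbits of two distinct
points `a`, `b` of the disk under the transition maps `φ_{0,t}`.

*Omission bounds the contraction from below.* For each `t` the function `f_t - w₀` is univalent and
zero-free, so it has a holomorphic logarithm, and by injectivity the image of the logarithm meets
no two points differing by `2πi`; in particular it contains no disk of radius `4`. A Bloch-type
theorem (`norm_deriv_mul_le_of_forall_not_ball_subset_image`) bounds the hyperbolic derivative of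
the logarithm by an absolute constant. Since `f_t(a_t) = f_0(a)` and `f_t(b_t) = f_0(b)`, the
quotient `(f_0(b) - w₀) / (f_0(a) - w₀)` is `exp v` with `v` bounded by a multiple of the
pseudo-hyperbolic distance of `a_t` and `b_t`. If that distance tends to zero, then
`f_0(a) = f_0(b)`, contradicting injectivity.

*The orbits come together.* If `|τ| < 1`, the modulus of `(a_t - τ) / (1 - conj τ * a_t)` decays
exponentially because `Re p ≥ C₁`, so every orbit tends to `τ`
(`tendsto_denjoyWolff_of_norm_lt_one`). If `|τ| = 1`, pass to the right half-plane by
`x = (τ + z) / (τ - z)`, where the equation reads `x' = 2 p`. The bound `Re p ≤ C₂` gives linear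
growth `Re x_t ≤ q + 2 C₂ t`. For two orbits `x`, `y`, the Schwarz-Pick inequality for `p - C₁ / 2`
shows that the derivative of `log (|x - y|² / (Re x * Re y))` is at most
`-C₁ / Re x ≤ -C₁ / (q + 2 C₂ t)`, which has a divergent integral
(`tendsto_pseudohyperbolic_of_norm_eq_one`).

*Absolute continuity.* The differential equation holds only almost everywhere, so integrating it
requires `t ↦ φ_{0,t}(z)` to be locally absolutely continuous
(`IsLoewnerChain.locallyAC_transitionMap`). Near a time `t₀` the functions `f_t` and their
derivatives are close to those of `f_{t₀}`, and `f_{t₀}' ≠ 0`, so that `f_t` expands distances near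
`φ_{0,t₀}(z)` by a definite factor; as `f_t(φ_{0,t}(z))` does not depend on `t`, the regularity
bound for `t ↦ f_t` passes to `t ↦ φ_{0,t}(z)`.
-/

open Filter Topology

/-! ### Univalent functions and the Schwarz-Pick inequality -/

/-- The inverse of an injective holomorphic function is continuous, and holomorphic off the images
of the isolated critical points, hence holomorphic; so there are no critical points. -/
theorem deriv_ne_zero_of_injOn {f : ℂ → ℂ} {U : Set ℂ} (hU : IsOpen U)
    (hf : DifferentiableOn ℂ f U) (hinj : InjOn f U) {a : ℂ} (ha : a ∈ U) : deriv f a ≠ 0 := by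
  have han : AnalyticOnNhd ℂ f U := hf.analyticOnNhd hU
  have hnotconst : ∀ z ∈ U, ¬ ∀ᶠ y in 𝓝 z, f y = f z := by
    intro z hz h
    have h2 : ∀ᶠ y in 𝓝 z, y = z := by
      filter_upwards [h, hU.mem_nhds hz] with y hy hyU using hinj hyU hz hy
    have : ∀ᶠ y in 𝓝[≠] z, False := by
      filter_upwards [nhdsWithin_le_nhds h2, self_mem_nhdsWithin] with y hy hy' using hy' hy
    exact this.exists.elim fun _ h => h
  have hmap : ∀ z ∈ U, map f (𝓝 z) = 𝓝 (f z) := fun z hz =>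
    le_antisymm (han z hz).continuousAt
      ((han z hz).eventually_constant_or_nhds_le_map_nhds.resolve_left (hnotconst z hz))
  set g := Function.invFunOn f U
  have hgf : ∀ z ∈ U, g (f z) = z := fun z hz => hinj.leftInvOn_invFunOn hz
  have hgcont : ∀ z ∈ U, ContinuousAt g (f z) := by
    intro z hz
    rw [ContinuousAt, ← hmap z hz, tendsto_map'_iff, hgf z hz]
    refine tendsto_id.congr' ?_
    filter_upwards [hU.mem_nhds hz] with y hy using (hgf y hy).symm
  have hfg : ∀ z ∈ U, ∀ᶠ y in 𝓝 (f z), f (g y) = y := by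
    intro z hz
    rw [← hmap z hz, eventually_map]
    filter_upwards [hU.mem_nhds hz] with y hy
    rw [hgf y hy]
  have hgdiff : ∀ z ∈ U, deriv f z ≠ 0 → DifferentiableAt ℂ g (f z) := by
    intro z hz h
    refine (HasDerivAt.of_local_left_inverse (hgcont z hz) ?_ h (hfg z hz)).differentiableAt
    rw [hgf z hz]
    exact (han z hz).differentiableAt.hasDerivAt
  -- the critical points are isolated, so `g` is holomorphic near `f a` by removability
  have hiso : ∀ᶠ z in 𝓝[≠] a, deriv f z ≠ 0 := by
    refine (han a ha).deriv.eventually_eq_zero_or_eventually_ne_zero.resolve_left fun h => ?_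
    obtain ⟨r, hr, hball⟩ := Metric.eventually_nhds_iff_ball.1 (h.and (hU.mem_nhds ha))
    refine hnotconst a ha ?_
    filter_upwards [Metric.ball_mem_nhds a hr] with y hy
    exact Metric.isOpen_ball.is_const_of_deriv_eq_zero (convex_ball a r).isPreconnected
      (fun z hz => (hf.differentiableAt (hU.mem_nhds (hball z hz).2)).differentiableWithinAt)
      (fun z hz => (hball z hz).1) hy (Metric.mem_ball_self hr)
  have hg1 : ∀ᶠ y in 𝓝[≠] (f a), DifferentiableAt ℂ g y := by
    rw [eventually_nhdsWithin_iff, ← hmap a ha, eventually_map]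
    filter_upwards [eventually_nhdsWithin_iff.1 hiso, hU.mem_nhds ha] with z hz hzU hne
    exact hgdiff z hzU (hz fun h => hne (by rw [mem_singleton_iff.1 h]; rfl))
  have hg2 : DifferentiableAt ℂ g (f a) :=
    (Complex.analyticAt_of_differentiable_on_punctured_nhds_of_continuousAt hg1
      (hgcont a ha)).differentiableAt
  have h1 : HasDerivAt (g ∘ f) (deriv g (f a) * deriv f a) a :=
    hg2.hasDerivAt.comp a (han a ha).differentiableAt.hasDerivAt
  have h2 : HasDerivAt (g ∘ f) 1 a := by
    refine (hasDerivAt_id a).congr_of_eventuallyEq ?_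
    filter_upwards [hU.mem_nhds ha] with y hy using hgf y hy
  intro h0
  simpa [h0] using h1.unique h2

/-- The identity behind invariance of the pseudo-hyperbolic distance `|b - a| / |1 - conj a * b|`. -/
theorem norm_sq_one_sub_conj_mul (a b : ℂ) :
    ‖1 - conj a * b‖ ^ 2 = ‖b - a‖ ^ 2 + (1 - ‖a‖ ^ 2) * (1 - ‖b‖ ^ 2) := by
  simp only [Complex.sq_norm, Complex.normSq_apply]
  simp
  ring

/-- An automorphism of the disk moving `0` to `a`; the point `u` which it moves to `b` has modulus
equal to the pseudo-hyperbolic distance of `a` and `b`. -/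
theorem exists_diskAutomorphism {a b : ℂ} (ha : a ∈ Metric.ball (0 : ℂ) 1)
    (hb : b ∈ Metric.ball (0 : ℂ) 1) :
    ∃ (n : ℂ → ℂ) (u : ℂ), DifferentiableOn ℂ n (Metric.ball 0 1) ∧
      MapsTo n (Metric.ball 0 1) (Metric.ball 0 1) ∧ InjOn n (Metric.ball 0 1) ∧
      n 0 = a ∧ n u = b ∧ u ∈ Metric.ball (0 : ℂ) 1 ∧
      ‖u‖ ^ 2 * (‖b - a‖ ^ 2 + (1 - ‖a‖ ^ 2) * (1 - ‖b‖ ^ 2)) = ‖b - a‖ ^ 2 := by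
  simp only [mem_ball_zero_iff] at ha hb
  have key : ∀ {z w : ℂ}, ‖z‖ < 1 → ‖w‖ < 1 → 1 - conj z * w ≠ 0 := by
    intro z w hz hw h
    have : ‖conj z * w‖ = 1 := by rw [← sub_eq_zero.1 h]; simp
    rw [norm_mul, RCLike.norm_conj] at this
    nlinarith [norm_nonneg z, norm_nonneg w]
  have hlt : ∀ {z w : ℂ}, ‖z‖ < 1 → ‖w‖ < 1 → ‖(w - z) / (1 - conj z * w)‖ < 1 := by
    intro z w hz hw
    rw [norm_div, div_lt_one (norm_pos_iff.2 (key hz hw))]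
    refine lt_of_pow_lt_pow_left₀ 2 (norm_nonneg _) ?_
    rw [norm_sq_one_sub_conj_mul]
    have h1 : 0 < 1 - ‖z‖ ^ 2 := by nlinarith [norm_nonneg z]
    have h2 : 0 < 1 - ‖w‖ ^ 2 := by nlinarith [norm_nonneg w]
    nlinarith [mul_pos h1 h2]
  have hna : ‖-a‖ < 1 := by rwa [norm_neg]
  have hz0 : ∀ {z : ℂ}, ‖z‖ < 1 → 1 + conj a * z ≠ 0 := by
    intro z hz
    have := key hna hz
    simpa using this
  have ha0 : 1 - conj a * a ≠ 0 := key ha ha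
  refine ⟨fun z => (z + a) / (1 + conj a * z), (b - a) / (1 - conj a * b), ?_, ?_, ?_, ?_, ?_, ?_,
    ?_⟩
  · intro z hz
    have := hz0 (mem_ball_zero_iff.1 hz)
    fun_prop (disch := assumption)
  · intro z hz
    have := hlt hna (mem_ball_zero_iff.1 hz)
    rw [mem_ball_zero_iff]
    simpa using this
  · intro z hz w hw h
    have h1 := hz0 (mem_ball_zero_iff.1 hz)
    have h2 := hz0 (mem_ball_zero_iff.1 hw)
    simp only at h
    rw [div_eq_div_iff h1 h2] at h
    have : (z - w) * (1 - conj a * a) = 0 := by linear_combination h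
    exact sub_eq_zero.1 ((mul_eq_zero.1 this).resolve_right ha0)
  · simp
  · have h1 := key ha hb
    have h2 : 1 + conj a * ((b - a) / (1 - conj a * b)) ≠ 0 := hz0 (hlt ha hb)
    simp only
    have hq : (b - a) / (1 - conj a * b) * (1 - conj a * b) = b - a := div_mul_cancel₀ _ h1
    rw [div_eq_iff h2]
    linear_combination hq
  · rw [mem_ball_zero_iff]; exact hlt ha hb
  · have h1 := key ha hb
    rw [← norm_sq_one_sub_conj_mul, norm_div, div_pow]
    exact div_mul_cancel₀ _ (pow_ne_zero 2 (norm_ne_zero_iff.2 h1))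

/-- The Schwarz-Pick inequality for holomorphic functions from the disk to the right half-plane, in
a form without denominators. -/
theorem schwarzPick_rightHalfPlane {h : ℂ → ℂ} (hh : DifferentiableOn ℂ h (Metric.ball 0 1))
    (hre : ∀ z ∈ Metric.ball (0 : ℂ) 1, 0 < (h z).re) {a b : ℂ}
    (ha : a ∈ Metric.ball (0 : ℂ) 1) (hb : b ∈ Metric.ball (0 : ℂ) 1) :
    ‖h a - h b‖ ^ 2 * ((1 - ‖a‖ ^ 2) * (1 - ‖b‖ ^ 2)) ≤
      4 * (h a).re * (h b).re * ‖a - b‖ ^ 2 := by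
  obtain ⟨n, u, hn, hmaps, -, h0, hu, hu1, hnorm⟩ := exists_diskAutomorphism ha hb
  have hid : ∀ v : ℂ, ‖v + conj (h a)‖ ^ 2 = ‖v - h a‖ ^ 2 + 4 * (h a).re * v.re := by
    intro v
    simp only [Complex.sq_norm, Complex.normSq_apply]
    simp
    ring
  have hpos := hre a ha
  have hlt : ∀ v : ℂ, 0 < v.re → ‖v - h a‖ < ‖v + conj (h a)‖ := by
    intro v hv
    refine lt_of_pow_lt_pow_left₀ 2 (norm_nonneg _) ?_
    rw [hid]
    have := mul_pos hpos hv
    linarith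
  have hne : ∀ v : ℂ, 0 < v.re → v + conj (h a) ≠ 0 := fun v hv =>
    norm_pos_iff.1 ((norm_nonneg _).trans_lt (hlt v hv))
  set g : ℂ → ℂ := fun ζ => (h (n ζ) - h a) / (h (n ζ) + conj (h a)) with hg
  have hgd : DifferentiableOn ℂ g (Metric.ball 0 1) := by
    have hc : DifferentiableOn ℂ (fun ζ => h (n ζ)) (Metric.ball 0 1) := hh.comp hn hmaps
    exact (hc.sub_const _).div (hc.add_const _) fun ζ hζ => hne _ (hre _ (hmaps hζ))
  have hgm : MapsTo g (Metric.ball 0 1) (Metric.ball 0 1) := by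
    intro ζ hζ
    have hp := hre _ (hmaps hζ)
    rw [mem_ball_zero_iff, hg, norm_div, div_lt_one (norm_pos_iff.2 (hne _ hp))]
    exact hlt _ hp
  have hg0 : g 0 = 0 := by simp [hg, h0]
  have hs := Complex.norm_le_norm_of_mapsTo_ball hgd (hgm.mono_right Metric.ball_subset_closedBall)
    hg0 (mem_ball_zero_iff.1 hu1)
  have hb0 := hre b hb
  have hD := norm_pos_iff.2 (hne _ hb0)
  simp only [hg, hu, norm_div] at hs
  rw [div_le_iff₀ hD] at hs
  have hs2 : ‖h b - h a‖ ^ 2 ≤ ‖u‖ ^ 2 * (‖h b - h a‖ ^ 2 + 4 * (h a).re * (h b).re) := by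
    rw [← hid, ← mul_pow]
    exact pow_le_pow_left₀ (norm_nonneg _) hs 2
  rw [norm_sub_rev (h a), norm_sub_rev a]
  have hN : 0 < (1 - ‖a‖ ^ 2) * (1 - ‖b‖ ^ 2) := by
    rw [mem_ball_zero_iff] at ha hb
    exact mul_pos (by nlinarith [norm_nonneg a]) (by nlinarith [norm_nonneg b])
  set N := (1 - ‖a‖ ^ 2) * (1 - ‖b‖ ^ 2)
  set A := ‖h b - h a‖ ^ 2
  set B := ‖b - a‖ ^ 2
  have hB : 0 ≤ B := sq_nonneg _
  have := mul_le_mul_of_nonneg_right hs2 (by positivity : 0 ≤ B + N)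
  have e : ‖u‖ ^ 2 * (A + 4 * (h a).re * (h b).re) * (B + N) = B * (A + 4 * (h a).re * (h b).re) := by
    linear_combination (A + 4 * (h a).re * (h b).re) * hnorm
  nlinarith

/-! ### A Bloch-type bound for functions omitting a value -/

/-- A weak form of Bloch's theorem: the image of a disk of radius `ρ` under `F` contains a disk of
radius comparable to `‖F' c‖ * ρ`. -/
theorem norm_deriv_mul_le_of_forall_not_ball_subset_image {F : ℂ → ℂ} {c : ℂ} {ρ R : ℝ}
    (hρ : 0 < ρ) (hR : 0 < R) (hF : DifferentiableOn ℂ F (Metric.ball c ρ))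
    (hball : ∀ w, ¬ Metric.ball w R ⊆ F '' Metric.ball c ρ) :
    ‖deriv F c‖ * ρ ≤ 96 * R := by
  have hsub : Metric.closedBall c (ρ / 2) ⊆ Metric.ball c ρ :=
    Metric.closedBall_subset_ball (by linarith)
  have hF' : DifferentiableOn ℂ (deriv F) (Metric.ball c ρ) := hF.deriv Metric.isOpen_ball
  -- The weight vanishes on the boundary of `closedBall c (ρ / 2)`. Hence near a maximizer `a`, on
  -- a disk of radius `σ`, half the distance from `a` to that boundary, `|F'|` is at most twice its
  -- value at `a`.
  obtain ⟨a, ha, hmax⟩ := (isCompact_closedBall c (ρ / 2)).exists_isMaxOn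
    (Metric.nonempty_closedBall.2 (by positivity))
    (f := fun z => (ρ / 2 - dist z c) * ‖deriv F z‖)
    (((continuous_const.sub (continuous_id.dist continuous_const)).continuousOn).mul
      (hF'.continuousOn.mono hsub).norm)
  by_contra! hcon
  set M := (ρ / 2 - dist a c) * ‖deriv F a‖ with hM
  have hM0 : 48 * R < M := by
    have h := hmax (Metric.mem_closedBall_self (by positivity : (0 : ℝ) ≤ ρ / 2))
    simp only [mem_ofPred_eq, dist_self] at h
    linarith
  have hMpos : 0 < M := by linarith
  rw [Metric.mem_closedBall] at ha
  have hd : 0 < ρ / 2 - dist a c := by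
    rcases (sub_nonneg.2 ha).eq_or_lt with h | h
    · rw [← h, zero_mul] at hM; linarith
    · exact h
  set σ := (ρ / 2 - dist a c) / 2 with hσ
  have hσ0 : 0 < σ := by positivity
  set m := ‖deriv F a‖ with hm
  have hMm : M = 2 * σ * m := by rw [hM]; ring
  have hm0 : 0 < m := by
    by_contra! h
    nlinarith
  have hin : ∀ z ∈ Metric.ball a σ, ‖deriv F z‖ ≤ 2 * m := by
    intro z hz
    rw [Metric.mem_ball] at hz
    have htri := dist_triangle z a c
    have hz' : z ∈ Metric.closedBall c (ρ / 2) := by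
      rw [Metric.mem_closedBall]; linarith
    have h : (ρ / 2 - dist z c) * ‖deriv F z‖ ≤ M := hmax hz'
    have h2 : σ * ‖deriv F z‖ ≤ σ * (2 * m) := by
      have : σ * ‖deriv F z‖ ≤ (ρ / 2 - dist z c) * ‖deriv F z‖ :=
        mul_le_mul_of_nonneg_right (by linarith) (norm_nonneg _)
      linarith
    exact le_of_mul_le_mul_left h2 hσ0
  have hsubσ : Metric.ball a σ ⊆ Metric.ball c ρ := by
    intro z hz
    rw [Metric.mem_ball] at hz ⊢
    linarith [dist_triangle z a c]
  -- By the Schwarz lemma for `deriv F`, the function `F` is nearly affine on a disk of radius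
  -- `σ / 6` around `a`.
  have hder : ∀ z ∈ Metric.ball a σ, ‖deriv F z - deriv F a‖ ≤ 3 * m / σ * dist z a := by
    intro z hz
    rw [← dist_eq_norm]
    refine Complex.dist_le_div_mul_dist_of_mapsTo_ball (hF'.mono hsubσ) (fun w hw => ?_) hz
    rw [Metric.mem_closedBall, dist_eq_norm]
    linarith [norm_sub_le (deriv F w) (deriv F a), hin w hw]
  set r := σ / 6 with hr
  have hr0 : 0 < r := by positivity
  have hrσ : Metric.closedBall a r ⊆ Metric.ball a σ :=
    Metric.closedBall_subset_ball (by linarith)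
  have hlin : ∀ z ∈ Metric.closedBall a r,
      ‖(F z - deriv F a * z) - (F a - deriv F a * a)‖ ≤ m / 2 * ‖z - a‖ := by
    intro z hz
    have hdiff : ∀ w ∈ Metric.closedBall a r,
        HasDerivWithinAt (fun w => F w - deriv F a * w) (deriv F w - deriv F a)
          (Metric.closedBall a r) w := by
      intro w hw
      have h1 : HasDerivAt F (deriv F w) w :=
        (hF.differentiableAt (Metric.isOpen_ball.mem_nhds (hsubσ (hrσ hw)))).hasDerivAt
      have h2 := h1.fun_sub ((hasDerivAt_id w).const_mul (deriv F a))
      simpa using h2.hasDerivWithinAt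
    refine (convex_closedBall a r).norm_image_sub_le_of_norm_hasDerivWithin_le hdiff
      (fun w hw => ?_) (Metric.mem_closedBall_self hr0.le) hz
    refine (hder w (hrσ hw)).trans ?_
    rw [Metric.mem_closedBall] at hw
    calc 3 * m / σ * dist w a ≤ 3 * m / σ * r := by gcongr
      _ = m / 2 := by rw [hr]; field_simp; norm_num
  have hdc : DiffContOnCl ℂ F (Metric.ball a r) := by
    refine DifferentiableOn.diffContOnCl ?_
    rw [closure_ball a hr0.ne']
    exact hF.mono (hrσ.trans hsubσ)
  have hlow : ∀ z ∈ Metric.closedBall a r, m / 2 * ‖z - a‖ ≤ ‖F z - F a‖ := by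
    intro z hz
    have h1 := hlin z hz
    have h2 : deriv F a * (z - a) =
      (F z - F a) - ((F z - deriv F a * z) - (F a - deriv F a * a)) := by ring
    have h3 : m * ‖z - a‖ ≤ ‖F z - F a‖ + ‖(F z - deriv F a * z) - (F a - deriv F a * a)‖ := by
      rw [hm, ← norm_mul, h2]; exact norm_sub_le _ _
    linarith
  have himg := hdc.ball_subset_image_closedBall hr0 (ε := m / 2 * r) (fun z hz => by
      have := hlow z (Metric.sphere_subset_closedBall hz)
      rwa [← dist_eq_norm z a, Metric.mem_sphere.1 hz] at this) (by
    have : ∀ᶠ z in nhdsWithin a {a}ᶜ, F z ≠ F a := by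
      filter_upwards [nhdsWithin_le_nhds (Metric.closedBall_mem_nhds a hr0), self_mem_nhdsWithin]
        with z hz hne h
      have h1 := hlow z hz
      rw [h, sub_self, norm_zero] at h1
      have : 0 < ‖z - a‖ := norm_pos_iff.2 (sub_ne_zero.2 hne)
      nlinarith
    exact this.frequently.filter_mono nhdsWithin_le_nhds)
  refine hball (F a) ((Metric.ball_subset_ball ?_).trans (himg.trans
    (image_mono (hrσ.trans hsubσ))))
  rw [hr]
  linarith

theorem exists_differentiableOn_log {h : ℂ → ℂ} {c : ℂ} {ρ : ℝ}
    (hh : DifferentiableOn ℂ h (Metric.ball c ρ)) (h0 : ∀ z ∈ Metric.ball c ρ, h z ≠ 0) :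
    ∃ l : ℂ → ℂ, DifferentiableOn ℂ l (Metric.ball c ρ) ∧
      ∀ z ∈ Metric.ball c ρ, Complex.exp (l z) = h z := by
  rcases le_or_gt ρ 0 with hρ | hρ
  · rw [Metric.ball_eq_empty.2 hρ]
    exact ⟨0, by simp, by simp⟩
  have hc : c ∈ Metric.ball c ρ := Metric.mem_ball_self hρ
  have hd : DifferentiableOn ℂ (fun z => deriv h z / h z) (Metric.ball c ρ) :=
    (hh.deriv Metric.isOpen_ball).div hh h0
  obtain ⟨l, hl0, hl⟩ := hd.isExactOn_ball.with_val_at c (Complex.log (h c))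
  refine ⟨l, fun z hz => (hl z hz).differentiableAt.differentiableWithinAt, fun z hz => ?_⟩
  have hder : ∀ w ∈ Metric.ball c ρ,
      HasDerivAt (fun w => h w * Complex.exp (-l w)) 0 w := by
    intro w hw
    have h1 := (hh.differentiableAt (Metric.isOpen_ball.mem_nhds hw)).hasDerivAt
    have h2 := h1.mul (hl w hw).neg.cexp
    convert! h2 using 1
    have := h0 w hw
    field_simp
    simp
  have hconst : h z * Complex.exp (-l z) = h c * Complex.exp (-l c) :=
    Metric.isOpen_ball.is_const_of_deriv_eq_zero (convex_ball c ρ).isPreconnected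
      (fun w hw => (hder w hw).differentiableAt.differentiableWithinAt)
      (fun w hw => (hder w hw).deriv) hz hc
  rw [hl0, Complex.exp_neg, Complex.exp_neg, Complex.exp_log (h0 c hc),
    mul_inv_cancel₀ (h0 c hc)] at hconst
  exact (mul_inv_eq_one₀ (Complex.exp_ne_zero _)).1 hconst |>.symm

/-- A univalent `g` omitting `w₀` varies slowly relative to its distance to `w₀`: a logarithm of
`g - w₀` takes no two values differing by `2πi`, so Bloch's theorem bounds its derivative. -/
theorem exists_sub_eq_mul_exp_of_omits {g : ℂ → ℂ} (hg : DifferentiableOn ℂ g (Metric.ball 0 1))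
    (hinj : InjOn g (Metric.ball 0 1)) {w₀ : ℂ} (hw : ∀ z ∈ Metric.ball (0 : ℂ) 1, g z ≠ w₀)
    {u : ℂ} (hu : ‖u‖ < 1 / 2) :
    ∃ v : ℂ, ‖v‖ ≤ 768 * ‖u‖ ∧ (g u - w₀) = (g 0 - w₀) * Complex.exp v := by
  obtain ⟨l, hl, hexp⟩ := exists_differentiableOn_log (hg.sub_const w₀)
    (fun z hz => sub_ne_zero.2 (hw z hz))
  have h0 : (0 : ℂ) ∈ Metric.ball (0 : ℂ) 1 := by simp
  have hu1 : u ∈ Metric.ball (0 : ℂ) 1 := by rw [mem_ball_zero_iff]; linarith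
  refine ⟨l u - l 0, ?_, ?_⟩
  -- A disk of radius `4 > π` contains the points `c ± πi`, which have the same exponential.
  · have hnb : ∀ c, ¬ Metric.ball c 4 ⊆ l '' Metric.ball 0 1 := by
      intro c hc
      have hπ : ‖(Real.pi : ℂ) * Complex.I‖ < 4 := by
        rw [norm_mul, Complex.norm_I, mul_one, Complex.norm_real, Real.norm_eq_abs,
          abs_of_pos Real.pi_pos]
        exact Real.pi_lt_four
      obtain ⟨z₁, hz₁, e₁⟩ := hc (by simpa using hπ : c + Real.pi * Complex.I ∈ Metric.ball c 4)
      obtain ⟨z₂, hz₂, e₂⟩ := hc (by simpa using hπ : c - Real.pi * Complex.I ∈ Metric.ball c 4)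
      have hper : l z₁ = l z₂ + 2 * Real.pi * Complex.I := by rw [e₁, e₂]; ring
      have heq : g z₁ = g z₂ := by
        have h1 := hexp z₁ hz₁
        rw [hper, Complex.exp_add, Complex.exp_two_pi_mul_I, mul_one, hexp z₂ hz₂] at h1
        exact (sub_left_inj.1 h1).symm
      rw [hinj hz₁ hz₂ heq] at hper
      have : (2 * Real.pi * Complex.I : ℂ) = 0 := by linear_combination -hper
      exact Complex.two_pi_I_ne_zero this
    have hder : ∀ ζ ∈ Metric.ball (0 : ℂ) (1 / 2), ‖deriv l ζ‖ ≤ 768 := by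
      intro ζ hζ
      have hs : Metric.ball ζ (1 / 2) ⊆ Metric.ball (0 : ℂ) 1 :=
        Metric.ball_subset_ball' (by rw [Metric.mem_ball] at hζ; linarith)
      have := norm_deriv_mul_le_of_forall_not_ball_subset_image (by norm_num : (0 : ℝ) < 1 / 2)
        (by norm_num : (0 : ℝ) < 4) (hl.mono hs) fun c hc => hnb c (hc.trans (image_mono hs))
      linarith
    have := (convex_ball (0 : ℂ) (1 / 2)).norm_image_sub_le_of_norm_deriv_le (f := l) (C := 768)
      (fun ζ hζ => hl.differentiableAt (Metric.isOpen_ball.mem_nhds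
        (Metric.ball_subset_ball (by norm_num) hζ))) hder
      (Metric.mem_ball_self (by norm_num)) (mem_ball_zero_iff.2 hu)
    simpa using this
  · rw [Complex.exp_sub, hexp u hu1, hexp 0 h0]
    have : g 0 - w₀ ≠ 0 := sub_ne_zero.2 (hw 0 h0)
    field_simp

/-! ### Local absolute continuity -/

theorem AbsolutelyContinuousOnInterval.of_dist_le {X Y : Type*} [PseudoMetricSpace X]
    [PseudoMetricSpace Y] {F : ℝ → X} {G : ℝ → Y} {a b K : ℝ}
    (hG : AbsolutelyContinuousOnInterval G a b)
    (h : ∀ s ∈ uIcc a b, ∀ t ∈ uIcc a b, dist (F s) (F t) ≤ K * dist (G s) (G t)) :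
    AbsolutelyContinuousOnInterval F a b := by
  have h0 := Tendsto.const_mul K hG
  rw [mul_zero] at h0
  refine squeeze_zero' (Eventually.of_forall fun E => Finset.sum_nonneg fun _ _ => dist_nonneg)
    ?_ h0
  filter_upwards [mem_inf_of_right (mem_principal_self _)] with E hE
  rw [Finset.mul_sum]
  exact Finset.sum_le_sum fun i hi => h _ (hE.1 i hi).1 _ (hE.1 i hi).2

theorem AbsolutelyContinuousOnInterval.prodMk {X Y : Type*} [PseudoMetricSpace X]
    [PseudoMetricSpace Y] {F : ℝ → X} {G : ℝ → Y} {a b : ℝ}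
    (hF : AbsolutelyContinuousOnInterval F a b) (hG : AbsolutelyContinuousOnInterval G a b) :
    AbsolutelyContinuousOnInterval (fun t => (F t, G t)) a b := by
  have h0 := Tendsto.add hF hG
  rw [add_zero] at h0
  refine squeeze_zero (fun E => Finset.sum_nonneg fun _ _ => dist_nonneg) (fun E => ?_) h0
  rw [← Finset.sum_add_distrib]
  refine Finset.sum_le_sum fun i _ => ?_
  rw [Prod.dist_eq]
  exact max_le_add_of_nonneg dist_nonneg dist_nonneg

/-- Local absolute continuity on `[0, ∞)`: around every `t₀ ≥ 0` there is a neighbourhood such that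
`F` is absolutely continuous on each compact interval contained in it and in `[0, ∞)`. The values of
`F` at negative times play no role. -/
def LocallyAC {X : Type*} [PseudoMetricSpace X] (F : ℝ → X) : Prop :=
  ∀ t₀ : ℝ, 0 ≤ t₀ → ∃ ε > 0, ∀ a b : ℝ, 0 ≤ a → t₀ - ε ≤ a → a ≤ b → b ≤ t₀ + ε →
    AbsolutelyContinuousOnInterval F a b

namespace LocallyAC

variable {X Y : Type*} [PseudoMetricSpace X] [PseudoMetricSpace Y]

theorem continuousOn {E : Type*} [NormedAddCommGroup E] {F : ℝ → E} (hF : LocallyAC F) : ContinuousOn F (Ici 0) := by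
  intro t ht
  have ht0 : 0 ≤ t := ht
  obtain ⟨ε, hε, h⟩ := hF t ht0
  obtain ⟨a, ha⟩ : ∃ a, a = max 0 (t - ε) := ⟨_, rfl⟩
  have ha0 : 0 ≤ a := ha ▸ le_max_left _ _
  have ha1 : t - ε ≤ a := ha ▸ le_max_right _ _
  have hat : a ≤ t := ha ▸ max_le ht0 (by linarith)
  have hle : a ≤ t + ε := by linarith
  have hc := (h a (t + ε) ha0 ha1 hle le_rfl).continuousOn
  rw [uIcc_of_le hle] at hc
  refine (hc t ⟨hat, by linarith⟩).mono_of_mem_nhdsWithin ?_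
  have h1 : Ioo (t - ε) (t + ε) ∈ 𝓝[Ici 0] t :=
    mem_nhdsWithin_of_mem_nhds (Ioo_mem_nhds (by linarith) (by linarith))
  filter_upwards [self_mem_nhdsWithin, h1] with s hs1 hs2
  exact ⟨ha ▸ max_le hs1 hs2.1.le, hs2.2.le⟩

theorem id : LocallyAC fun t : ℝ => t := fun _ _ =>
  ⟨1, one_pos, fun _ _ _ _ _ _ =>
    (LipschitzWith.id (α := ℝ)).lipschitzOnWith.absolutelyContinuousOnInterval⟩

theorem prodMk {F : ℝ → X} {G : ℝ → Y} (hF : LocallyAC F) (hG : LocallyAC G) :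
    LocallyAC fun t => (F t, G t) := by
  intro t ht
  obtain ⟨ε, hε, h⟩ := hF t ht
  obtain ⟨δ, hδ, h'⟩ := hG t ht
  refine ⟨min ε δ, lt_min hε hδ, fun a b h0 ha hab hb => ?_⟩
  have h1 := min_le_left ε δ
  have h2 := min_le_right ε δ
  exact (h a b h0 (by linarith) hab (by linarith)).prodMk (h' a b h0 (by linarith) hab (by linarith))

theorem comp_contDiffAt {E E' : Type*} [NormedAddCommGroup E] [NormedSpace ℝ E]
    [NormedAddCommGroup E'] [NormedSpace ℝ E'] {F : ℝ → E} {Φ : E → E'} (hF : LocallyAC F)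
    (hΦ : ∀ t : ℝ, 0 ≤ t → ContDiffAt ℝ 1 Φ (F t)) : LocallyAC fun t => Φ (F t) := by
  intro t ht
  obtain ⟨ε, hε, h⟩ := hF t ht
  obtain ⟨K, s, hs, hK⟩ := (hΦ t ht).exists_lipschitzOnWith
  have hev := hF.continuousOn t ht hs
  rw [mem_map, Metric.mem_nhdsWithin_iff] at hev
  obtain ⟨δ, hδ, hball⟩ := hev
  refine ⟨min ε (δ / 2), by positivity, fun a b h0 ha hab hb => ?_⟩
  have h1 := min_le_left ε (δ / 2)
  have h2 := min_le_right ε (δ / 2)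
  have hmem : ∀ u ∈ uIcc a b, F u ∈ s := by
    intro u hu
    rw [uIcc_of_le hab] at hu
    refine hball ⟨?_, h0.trans hu.1⟩
    rw [Metric.mem_ball, Real.dist_eq, abs_lt]
    constructor <;> linarith [hu.1, hu.2]
  exact (h a b h0 (by linarith) hab (by linarith)).of_dist_le fun u hu v hv =>
    hK.dist_le_mul _ (hmem u hu) _ (hmem v hv)

/-- The fundamental theorem of calculus gives monotonicity on short intervals; a connectedness
argument extends it to `[0, ∞)`. -/
theorem antitoneOn {F : ℝ → ℝ} (hF : LocallyAC F)
    (hd : ∀ᵐ t : ℝ, 0 < t → ∃ d ≤ 0, HasDerivAt F d t) : AntitoneOn F (Ici 0) := by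
  have hlocal : ∀ a b : ℝ, 0 ≤ a → a ≤ b → AbsolutelyContinuousOnInterval F a b → F b ≤ F a := by
    intro a b h0 hab hac
    rw [← sub_nonpos, ← hac.integral_deriv_eq_sub, intervalIntegral.integral_of_le hab]
    refine integral_nonpos_of_ae ?_
    refine (ae_restrict_iff' measurableSet_Ioc).2 ?_
    have h1 : ∀ᵐ t : ℝ, t ≠ 0 := by simp [ae_iff]
    filter_upwards [hd, h1] with t ht h1 hmem
    obtain ⟨d, hd, hder⟩ := ht (lt_of_le_of_ne (h0.trans hmem.1.le) h1.symm)
    rw [hder.deriv]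
    exact hd
  intro a ha b hb hab
  have hsub : Icc a b ⊆ {t | F t ≤ F a} := by
    refine IsClosed.Icc_subset_of_forall_mem_nhdsWithin ?_ (le_refl (F a)) fun t ht => ?_
    · have hc : ContinuousOn F (Icc a b) :=
        hF.continuousOn.mono fun t ht => le_trans (mem_Ici.1 ha) ht.1
      rw [inter_comm]
      exact hc.preimage_isClosed_of_isClosed isClosed_Icc isClosed_Iic
    · have ht0 : 0 ≤ t := le_trans (mem_Ici.1 ha) ht.2.1
      obtain ⟨ε, hε, h⟩ := hF t ht0
      filter_upwards [Ioo_mem_nhdsGT (show t < t + ε by linarith)] with s hs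
      exact (hlocal t s ht0 hs.1.le (h t s ht0 (by linarith) hs.1.le hs.2.le)).trans ht.1
  exact hsub ⟨hab, le_rfl⟩

end LocallyAC

/-! ### Regularity of the transition maps in time -/

theorem IsLoewnerChain.transitionMap_mem {f : ℝ → ℂ → ℂ} (hf : IsLoewnerChain f) {s t : ℝ}
    (hs : 0 ≤ s) (hst : s ≤ t) {z : ℂ} (hz : z ∈ Metric.ball (0 : ℂ) 1) :
    transitionMap f s t z ∈ Metric.ball (0 : ℂ) 1 :=
  ((hf.transitionMap_eq_iff hs hst hz).1 rfl).1

theorem IsLoewnerChain.apply_transitionMap {f : ℝ → ℂ → ℂ} (hf : IsLoewnerChain f) {s t : ℝ}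
    (hs : 0 ≤ s) (hst : s ≤ t) {z : ℂ} (hz : z ∈ Metric.ball (0 : ℂ) 1) :
    f t (transitionMap f s t z) = f s z :=
  ((hf.transitionMap_eq_iff hs hst hz).1 rfl).2

/-- Orbits of the transition maps are locally absolutely continuous in time. If `f_t` expands
distances by at least `c` near the orbit, then
`c * |φ_t - φ_s| ≤ |f_t(φ_t) - f_t(φ_s)| = |f_s(φ_s) - f_t(φ_s)|`,
and the right side is bounded by the regularity of `f`. -/
theorem IsLoewnerChain.locallyAC_transitionMap {f : ℝ → ℂ → ℂ} (hf : IsLoewnerChain f) {z : ℂ}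
    (hz : z ∈ Metric.ball (0 : ℂ) 1) : LocallyAC fun t => transitionMap f 0 t z := by
  intro t₀ ht₀
  set φ : ℝ → ℂ := fun t => transitionMap f 0 t z with hφ
  have hmem : ∀ t, 0 ≤ t → φ t ∈ Metric.ball (0 : ℂ) 1 := fun t ht =>
    hf.transitionMap_mem le_rfl ht hz
  have hval : ∀ t, 0 ≤ t → f t (φ t) = f 0 z := fun t ht =>
    hf.apply_transitionMap le_rfl ht hz
  set a := φ t₀ with ha
  obtain ⟨R', hR', hsub'⟩ := Metric.isOpen_ball.mem_nhds (hmem t₀ ht₀) |> Metric.mem_nhds_iff.1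
  obtain ⟨R, hR, hRR⟩ : ∃ R > 0, 2 * R < R' := ⟨R' / 3, by positivity, by linarith⟩
  have hsub : Metric.closedBall a (2 * R) ⊆ Metric.ball 0 1 :=
    (Metric.closedBall_subset_ball hRR).trans hsub'
  obtain ⟨k, -, hk, hfk⟩ := hf.regular _ (isCompact_closedBall a (2 * R)) hsub (t₀ + 1)
    (by linarith)
  have hkI : IntervalIntegrable k volume 0 (t₀ + 1) := by
    rw [intervalIntegrable_iff_integrableOn_Icc_of_le (by linarith)]; exact hk
  set G : ℝ → ℝ := fun t => ∫ u in (0 : ℝ)..t, k u with hG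
  have hGac : AbsolutelyContinuousOnInterval G 0 (t₀ + 1) :=
    hkI.absolutelyContinuousOnInterval_intervalIntegral left_mem_uIcc
  have hGbound : ∀ s ∈ Icc 0 (t₀ + 1), ∀ t ∈ Icc 0 (t₀ + 1), ∀ ζ ∈ Metric.closedBall a (2 * R),
      ‖f s ζ - f t ζ‖ ≤ |G s - G t| := by
    have hle : ∀ s t : ℝ, 0 ≤ s → s ≤ t → t ≤ t₀ + 1 → ∀ ζ ∈ Metric.closedBall a (2 * R),
        ‖f s ζ - f t ζ‖ ≤ |G s - G t| := by
      intro s t hs hst ht ζ hζ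
      have hI : ∀ u, 0 ≤ u → u ≤ t₀ + 1 → IntervalIntegrable k volume 0 u := fun u h0 h1 =>
        hkI.mono_set (by rw [uIcc_of_le h0, uIcc_of_le (h0.trans h1)]; exact Icc_subset_Icc_right h1)
      refine (hfk ζ hζ s t hs hst ht).trans ?_
      rw [abs_sub_comm, hG, intervalIntegral.integral_interval_sub_left
        (hI t (hs.trans hst) ht) (hI s hs (hst.trans ht))]
      exact le_abs_self _
    intro s hs t ht ζ hζ
    rcases le_total s t with h | h
    · exact hle s t hs.1 h ht.2 ζ hζ
    · rw [norm_sub_rev, abs_sub_comm]; exact hle t s ht.1 h hs.2 ζ hζ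
  have hdiff : ∀ t, 0 ≤ t → ∀ ζ ∈ Metric.ball (0 : ℂ) 1, DifferentiableAt ℂ (f t) ζ :=
    fun t ht ζ hζ => (hf.holomorphic t ht).differentiableAt (Metric.isOpen_ball.mem_nhds hζ)
  -- Cauchy's estimate turns the regularity bound into a bound on derivatives
  have hderiv : ∀ t ∈ Icc 0 (t₀ + 1), ∀ ζ ∈ Metric.closedBall a R,
      ‖deriv (f t) ζ - deriv (f t₀) ζ‖ ≤ |G t - G t₀| / R := by
    intro t ht ζ hζ
    have hs : Metric.closedBall ζ R ⊆ Metric.closedBall a (2 * R) :=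
      Metric.closedBall_subset_closedBall' (by rw [Metric.mem_closedBall] at hζ; linarith)
    have hζ1 : ζ ∈ Metric.ball (0 : ℂ) 1 := hsub (hs (Metric.mem_closedBall_self hR.le))
    rw [← deriv_fun_sub (hdiff t ht.1 ζ hζ1) (hdiff t₀ ht₀ ζ hζ1)]
    refine Complex.norm_deriv_le_of_forall_mem_sphere_norm_le hR ?_ fun w hw =>
      hGbound t ht t₀ ⟨ht₀, by linarith⟩ w (hs (Metric.sphere_subset_closedBall hw))
    refine DifferentiableOn.diffContOnCl ?_
    rw [closure_ball ζ hR.ne']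
    exact ((hf.holomorphic t ht.1).sub (hf.holomorphic t₀ ht₀)).mono (hs.trans hsub)
  have hm : 0 < ‖deriv (f t₀) a‖ := norm_pos_iff.2 (deriv_ne_zero_of_injOn Metric.isOpen_ball
    (hf.holomorphic t₀ ht₀) (hf.injective t₀ ht₀) (hmem t₀ ht₀))
  set m := ‖deriv (f t₀) a‖ with hmdef
  obtain ⟨r, hr, hrR, hrm⟩ : ∃ r > 0, r ≤ R ∧
      ∀ ζ ∈ Metric.closedBall a r, ‖deriv (f t₀) ζ - deriv (f t₀) a‖ ≤ m / 4 := by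
    have hc : ContinuousAt (deriv (f t₀)) a :=
      (((hf.holomorphic t₀ ht₀).deriv Metric.isOpen_ball).continuousOn).continuousAt
        (Metric.isOpen_ball.mem_nhds (hmem t₀ ht₀))
    obtain ⟨δ, hδ, h⟩ := Metric.continuousAt_iff.1 hc (m / 4) (by positivity)
    refine ⟨min R (δ / 2), by positivity, min_le_left _ _, fun ζ hζ => ?_⟩
    rw [← dist_eq_norm]
    refine (h ?_).le
    rw [Metric.mem_closedBall] at hζ
    linarith [min_le_right R (δ / 2)]
  have hrsub : Metric.closedBall a r ⊆ Metric.closedBall a (2 * R) :=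
    Metric.closedBall_subset_closedBall (by linarith)
  -- The conditions on `ε` make `deriv (f t)` `m / 2`-close to `deriv (f t₀) a` near `a`, and keep
  -- the orbit in `closedBall a r`.
  obtain ⟨ε, hε, hεG⟩ : ∃ ε > 0, ∀ t, 0 ≤ t → |t - t₀| ≤ ε → t ≤ t₀ + 1 ∧
      |G t - G t₀| ≤ R * (m / 4) ∧ |G t - G t₀| < m * r / 4 := by
    have hc : ContinuousWithinAt G (Icc 0 (t₀ + 1)) t₀ := by
      have := hGac.continuousOn
      rw [uIcc_of_le (by linarith)] at this
      exact this t₀ ⟨ht₀, by linarith⟩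
    obtain ⟨δ, hδ, h⟩ := Metric.continuousWithinAt_iff.1 hc (min (R * (m / 4)) (m * r / 4))
      (by positivity)
    refine ⟨min 1 (δ / 2), by positivity, fun t ht htt => ?_⟩
    have h1 : t ≤ t₀ + 1 := by linarith [le_abs_self (t - t₀), min_le_left 1 (δ / 2)]
    have h2 := h ⟨ht, h1⟩ (by rw [Real.dist_eq]; linarith [min_le_right 1 (δ / 2)])
    rw [Real.dist_eq] at h2
    exact ⟨h1, (h2.trans_le (min_le_left _ _)).le, h2.trans_le (min_le_right _ _)⟩
  have hlow : ∀ t, 0 ≤ t → |t - t₀| ≤ ε → ∀ b ∈ Metric.closedBall a r,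
      ∀ b' ∈ Metric.closedBall a r, m / 2 * ‖b - b'‖ ≤ ‖f t b - f t b'‖ := by
    intro t ht htt b hb b' hb'
    obtain ⟨ht1, hGR, -⟩ := hεG t ht htt
    have hd : ∀ w ∈ Metric.closedBall a r, HasDerivWithinAt (fun w => f t w - deriv (f t₀) a * w)
        (deriv (f t) w - deriv (f t₀) a) (Metric.closedBall a r) w := by
      intro w hw
      have h2 := (hdiff t ht w (hsub (hrsub hw))).hasDerivAt.fun_sub
        ((hasDerivAt_id w).const_mul (deriv (f t₀) a))
      simpa using h2.hasDerivWithinAt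
    have h1 := (convex_closedBall a r).norm_image_sub_le_of_norm_hasDerivWithin_le (C := m / 2) hd
      (fun w hw => ?_) hb' hb
    · have h2 : deriv (f t₀) a * (b - b') = (f t b - f t b') -
        ((f t b - deriv (f t₀) a * b) - (f t b' - deriv (f t₀) a * b')) := by ring
      have h3 : m * ‖b - b'‖ ≤ ‖f t b - f t b'‖ +
          ‖(f t b - deriv (f t₀) a * b) - (f t b' - deriv (f t₀) a * b')‖ := by
        rw [hmdef, ← norm_mul, h2]; exact norm_sub_le _ _
      linarith
    · have h2 := hderiv t ⟨ht, ht1⟩ w (Metric.closedBall_subset_closedBall hrR hw)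
      have h3 := hrm w hw
      have h4 : |G t - G t₀| / R ≤ m / 4 := by rw [div_le_iff₀ hR]; linarith
      calc ‖deriv (f t) w - deriv (f t₀) a‖
          ≤ ‖deriv (f t) w - deriv (f t₀) w‖ + ‖deriv (f t₀) w - deriv (f t₀) a‖ :=
            norm_sub_le_norm_sub_add_norm_sub _ _ _
        _ ≤ m / 2 := by linarith
  -- The image of `closedBall a r` under `f t` covers a disk around `f t a` containing `f 0 z`, so
  -- by injectivity `φ t` lies in that ball; this is the continuity of the orbit at `t₀`.
  have hnear : ∀ t, 0 ≤ t → |t - t₀| ≤ ε → φ t ∈ Metric.closedBall a r := by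
    intro t ht htt
    obtain ⟨ht1, -, hGr⟩ := hεG t ht htt
    have haa : a ∈ Metric.closedBall a r := Metric.mem_closedBall_self hr.le
    have hdc : DiffContOnCl ℂ (f t) (Metric.ball a r) := by
      refine DifferentiableOn.diffContOnCl ?_
      rw [closure_ball a hr.ne']
      exact (hf.holomorphic t ht).mono (hrsub.trans hsub)
    have himg := hdc.ball_subset_image_closedBall hr (ε := m / 2 * r) (fun w hw => by
        have := hlow t ht htt w (Metric.sphere_subset_closedBall hw) a haa
        rwa [← dist_eq_norm w a, Metric.mem_sphere.1 hw] at this) (by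
      have : ∀ᶠ w in 𝓝[≠] a, f t w ≠ f t a := by
        filter_upwards [nhdsWithin_le_nhds (Metric.closedBall_mem_nhds a hr), self_mem_nhdsWithin]
          with w hw hne h
        exact hne (hf.injective t ht (hsub (hrsub hw)) (hmem t₀ ht₀) h)
      exact this.frequently.filter_mono nhdsWithin_le_nhds)
    have hw : f 0 z ∈ Metric.ball (f t a) (m / 2 * r / 2) := by
      rw [Metric.mem_ball, ← hval t₀ ht₀, dist_eq_norm, norm_sub_rev]
      have := hGbound t ⟨ht, ht1⟩ t₀ ⟨ht₀, by linarith⟩ a (hrsub haa)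
      linarith
    obtain ⟨b, hb, hbw⟩ := himg hw
    have : φ t = b := hf.injective t ht (hmem t ht) (hsub (hrsub hb)) ((hval t ht).trans hbw.symm)
    rwa [this]
  refine ⟨ε, hε, fun s t hs hs1 hst ht1 => ?_⟩
  have habs : ∀ u ∈ uIcc s t, 0 ≤ u ∧ |u - t₀| ≤ ε := by
    intro u hu
    rw [uIcc_of_le hst] at hu
    exact ⟨hs.trans hu.1, abs_le.2 ⟨by linarith [hu.1], by linarith [hu.2]⟩⟩
  have hGst : AbsolutelyContinuousOnInterval G s t := by
    refine hGac.mono fun u hu => ?_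
    obtain ⟨h0, h1⟩ := habs u hu
    rw [uIcc_of_le (by linarith)]
    exact ⟨h0, (hεG u h0 h1).1⟩
  refine hGst.of_dist_le (K := 2 / m) fun u hu v hv => ?_
  obtain ⟨hu0, hu1⟩ := habs u hu
  obtain ⟨hv0, hv1⟩ := habs v hv
  have h1 := hlow v hv0 hv1 _ (hnear u hu0 hu1) _ (hnear v hv0 hv1)
  rw [hval v hv0, ← hval u hu0, norm_sub_rev (f v _)] at h1
  have h2 := hGbound u ⟨hu0, (hεG u hu0 hu1).1⟩ v ⟨hv0, (hεG v hv0 hv1).1⟩ _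
    (hrsub (hnear u hu0 hu1))
  rw [dist_eq_norm, Real.dist_eq, div_mul_eq_mul_div, le_div_iff₀ hm]
  linarith

/-! ### Orbits when the Denjoy-Wolff point is interior -/

/-- The exceptional null set in the bounds on `Re p` can be chosen independent of `z`: use a
countable dense set of points and continuity. -/
theorem ae_forall_re_mem_Icc {p : ℂ → ℝ → ℂ} {C₁ C₂ : ℝ} {U : Set ℂ} (hU : IsOpen U)
    (hp : ∀ t : ℝ, 0 ≤ t → ContinuousOn (fun z => p z t) U)
    (hbound : ∀ z ∈ U, ∀ᵐ t : ℝ, 0 ≤ t → C₁ < (p z t).re ∧ (p z t).re < C₂) :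
    ∀ᵐ t : ℝ, 0 ≤ t → ∀ z ∈ U, (p z t).re ∈ Icc C₁ C₂ := by
  obtain ⟨S, hS, hd⟩ := TopologicalSpace.exists_countable_dense ℂ
  have hae : ∀ᵐ t : ℝ, ∀ z ∈ S ∩ U, 0 ≤ t → C₁ < (p z t).re ∧ (p z t).re < C₂ :=
    (ae_ball_iff (hS.mono inter_subset_left)).2 fun z hz => hbound z hz.2
  filter_upwards [hae] with t ht ht0 z hz
  have hcl : z ∈ closure (U ∩ S) := hd.open_subset_closure_inter hU hz
  have hc : ContinuousWithinAt (fun z => (p z t).re) (U ∩ S) z :=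
    Complex.continuous_re.continuousAt.comp_continuousWithinAt
      (((hp t ht0) z hz).mono inter_subset_left)
  have := hc.mem_closure hcl (t := Icc C₁ C₂) fun w hw =>
    ⟨(ht w hw.symm ht0).1.le, (ht w hw.symm ht0).2.le⟩
  rwa [isClosed_Icc.closure_eq] at this

/-- With interior Denjoy-Wolff point `τ`, every orbit tends to `τ`: in the coordinate
`m = (φ - τ) / (1 - conj τ * φ)` the equation reads `m' = -(1 - ‖τ‖²) * m * p`. -/
theorem tendsto_denjoyWolff_of_norm_lt_one {φ : ℝ → ℂ} {p : ℂ → ℝ → ℂ} {τ : ℂ} {C₁ : ℝ} (hC₁ : 0 < C₁)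
    (hτ : ‖τ‖ < 1) (hφ : LocallyAC φ) (hmem : ∀ t, 0 ≤ t → φ t ∈ Metric.ball (0 : ℂ) 1)
    (hode : ∀ᵐ t : ℝ, 0 < t →
      HasDerivAt φ ((φ t - τ) * (conj τ * φ t - 1) * p (φ t) t) t)
    (hre : ∀ᵐ t : ℝ, 0 < t → C₁ ≤ (p (φ t) t).re) :
    Tendsto φ atTop (𝓝 τ) := by
  have hne : ∀ t, 0 ≤ t → 1 - conj τ * φ t ≠ 0 := by
    intro t ht h
    have h1 : ‖conj τ * φ t‖ = 1 := by rw [← sub_eq_zero.1 h]; simp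
    have h2 := mem_ball_zero_iff.1 (hmem t ht)
    rw [norm_mul, RCLike.norm_conj] at h1
    nlinarith [norm_nonneg τ, norm_nonneg (φ t)]
  set m : ℝ → ℂ := fun t => (φ t - τ) / (1 - conj τ * φ t) with hm
  set κ : ℝ := (1 - ‖τ‖ ^ 2) * C₁ with hκ
  have hτ2 : 0 < 1 - ‖τ‖ ^ 2 := by nlinarith [norm_nonneg τ]
  have hκ0 : 0 < κ := mul_pos hτ2 hC₁
  have hmac : LocallyAC m := by
    refine hφ.comp_contDiffAt (Φ := fun z => (z - τ) / (1 - conj τ * z)) fun t ht => ?_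
    have h : ContDiffAt ℂ 1 (fun z => (z - τ) / (1 - conj τ * z)) (φ t) :=
      (contDiffAt_id.sub contDiffAt_const).div
        (contDiffAt_const.sub (contDiffAt_const.mul contDiffAt_id)) (hne t ht)
    exact h.restrict_scalars ℝ
  set F : ℝ → ℝ := fun t => ‖m t‖ ^ 2 * Real.exp (2 * κ * t) with hF
  have hFac : LocallyAC F := by
    refine (hmac.prodMk LocallyAC.id).comp_contDiffAt
      (Φ := fun v : ℂ × ℝ => ‖v.1‖ ^ 2 * Real.exp (2 * κ * v.2)) fun t ht => ?_
    exact (contDiffAt_fst.norm_sq ℝ).mul (contDiffAt_const.mul contDiffAt_snd).exp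
  have hanti : AntitoneOn F (Ici 0) := by
    refine hFac.antitoneOn ?_
    filter_upwards [hode, hre] with t h1 h2 ht
    have hd := h1 ht
    have hn := hne t ht.le
    have hm' : HasDerivAt m (-((1 - ‖τ‖ ^ 2 : ℝ) : ℂ) * m t * p (φ t) t) t := by
      have h3 := (hd.sub_const τ).fun_div ((hd.const_mul (conj τ)).const_sub 1) hn
      convert! h3 using 1
      have h4 : ((1 - ‖τ‖ ^ 2 : ℝ) : ℂ) = 1 - conj τ * τ := by
        rw [← Complex.normSq_eq_conj_mul_self, Complex.normSq_eq_norm_sq]; simp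
      rw [h4, hm, eq_div_iff (pow_ne_zero 2 hn)]
      have h5 : (φ t - τ) / (1 - conj τ * φ t) * (1 - conj τ * φ t) ^ 2 =
          (φ t - τ) * (1 - conj τ * φ t) := by
        field_simp
      simp only
      linear_combination (-(1 - conj τ * τ) * p (φ t) t) * h5
    refine ⟨_, ?_, hm'.norm_sq.mul ((hasDerivAt_id t).const_mul (2 * κ)).exp⟩
    have hin : inner ℝ (m t) (-((1 - ‖τ‖ ^ 2 : ℝ) : ℂ) * m t * p (φ t) t) =
        -(1 - ‖τ‖ ^ 2) * ‖m t‖ ^ 2 * (p (φ t) t).re := by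
      rw [Complex.inner, Complex.sq_norm (m t), Complex.normSq_apply]
      set c := 1 - ‖τ‖ ^ 2
      simp
      ring
    rw [hin]
    have h6 := mul_le_mul_of_nonneg_left (h2 ht) (mul_nonneg hτ2.le (sq_nonneg ‖m t‖))
    have h7 : 2 * (-(1 - ‖τ‖ ^ 2) * ‖m t‖ ^ 2 * (p (φ t) t).re) * Real.exp (2 * κ * t) +
        ‖m t‖ ^ 2 * (Real.exp (2 * κ * t) * (2 * κ * 1)) =
        2 * Real.exp (2 * κ * t) * ((1 - ‖τ‖ ^ 2) * ‖m t‖ ^ 2 * C₁ -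
          (1 - ‖τ‖ ^ 2) * ‖m t‖ ^ 2 * (p (φ t) t).re) := by
      rw [hκ]; ring
    simp only [id]
    rw [h7]
    exact mul_nonpos_of_nonneg_of_nonpos (by positivity) (by linarith)
  rw [tendsto_iff_norm_sub_tendsto_zero]
  have hlim : Tendsto (fun t : ℝ => 2 * Real.sqrt (F 0 * Real.exp (-(2 * κ * t)))) atTop (𝓝 0) := by
    have h1 : Tendsto (fun t : ℝ => 2 * κ * t) atTop atTop :=
      tendsto_id.const_mul_atTop (by positivity)
    have h2 := ((Real.tendsto_exp_neg_atTop_nhds_zero.comp h1).const_mul (F 0)).sqrt.const_mul 2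
    simpa using h2
  refine squeeze_zero' (Eventually.of_forall fun t => norm_nonneg _) ?_ hlim
  filter_upwards [eventually_ge_atTop 0] with t ht
  have h1 : F t ≤ F 0 := hanti (mem_Ici.2 le_rfl) (mem_Ici.2 ht) ht
  have h2 : ‖m t‖ ≤ Real.sqrt (F 0 * Real.exp (-(2 * κ * t))) := by
    refine Real.le_sqrt_of_sq_le ?_
    rw [Real.exp_neg, ← div_eq_mul_inv, le_div_iff₀ (Real.exp_pos _)]
    exact h1
  have h3 : φ t - τ = m t * (1 - conj τ * φ t) := (div_mul_cancel₀ _ (hne t ht)).symm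
  have h4 : ‖1 - conj τ * φ t‖ ≤ 2 := by
    refine (norm_sub_le _ _).trans ?_
    rw [norm_mul, RCLike.norm_conj, norm_one]
    nlinarith [norm_nonneg τ, norm_nonneg (φ t), mem_ball_zero_iff.1 (hmem t ht)]
  rw [h3, norm_mul]
  nlinarith [norm_nonneg (m t)]

/-! ### Orbits when the Denjoy-Wolff point is on the boundary -/

theorem re_cayley_mul {τ z : ℂ} (hτ : ‖τ‖ = 1) (hz : τ - z ≠ 0) :
    ((τ + z) / (τ - z)).re * ‖τ - z‖ ^ 2 = 1 - ‖z‖ ^ 2 := by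
  have h : (τ + z) / (τ - z) = ((τ + z) * conj (τ - z)) / ((‖τ - z‖ ^ 2 : ℝ) : ℂ) := by
    rw [Complex.sq_norm, ← Complex.mul_conj,
      mul_div_mul_right _ _ ((map_ne_zero (starRingEnd ℂ)).2 hz)]
  have h0 : ‖τ - z‖ ^ 2 ≠ 0 := pow_ne_zero 2 (norm_ne_zero_iff.2 hz)
  have h1 : (1 : ℝ) = ‖τ‖ ^ 2 := by rw [hτ]; norm_num
  rw [h, Complex.div_ofReal_re, div_mul_cancel₀ _ h0, h1]
  simp only [Complex.sq_norm, Complex.normSq_apply]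
  simp
  ring

theorem norm_sq_cayley_sub_cayley_mul {τ z w : ℂ} (hτ : ‖τ‖ = 1) (hz : τ - z ≠ 0) (hw : τ - w ≠ 0) :
    ‖(τ + z) / (τ - z) - (τ + w) / (τ - w)‖ ^ 2 * (‖τ - z‖ ^ 2 * ‖τ - w‖ ^ 2) =
      4 * ‖z - w‖ ^ 2 := by
  have h : ((τ + z) / (τ - z) - (τ + w) / (τ - w)) * ((τ - z) * (τ - w)) = 2 * τ * (z - w) := by
    field_simp
    ring
  have h2 := congrArg (fun v => ‖v‖ ^ 2) h
  simp only [norm_mul, mul_pow, hτ] at h2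
  rw [h2]
  norm_num

theorem sub_ne_zero_of_mem_ball {τ z : ℂ} (hτ : ‖τ‖ = 1) (hz : z ∈ Metric.ball (0 : ℂ) 1) :
    τ - z ≠ 0 := by
  intro h
  rw [mem_ball_zero_iff, ← sub_eq_zero.1 h, hτ] at hz
  exact lt_irrefl _ hz

theorem re_cayley_pos {τ z : ℂ} (hτ : ‖τ‖ = 1) (hz : z ∈ Metric.ball (0 : ℂ) 1) :
    0 < ((τ + z) / (τ - z)).re := by
  have h1 := sub_ne_zero_of_mem_ball hτ hz
  have h2 := re_cayley_mul hτ h1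
  have h3 : 0 < ‖τ - z‖ ^ 2 := by positivity
  rw [mem_ball_zero_iff] at hz
  have h4 : 0 < 1 - ‖z‖ ^ 2 := by nlinarith [norm_nonneg z]
  rw [← h2] at h4
  exact pos_of_mul_pos_left h4 h3.le

/-- Infinitesimal contraction of the half-plane flow `x' = h`, stated for two points: the logarithmic
derivative of `|x - y|²` is at most the sum of those of `Re x` and `Re y`. It follows from the
Schwarz-Pick inequality `|h z - h w|² / |x - y|² ≤ (Re h z / Re x) * (Re h w / Re y)` and the
inequality of arithmetic and geometric means. -/
theorem inner_cayley_sub_cayley_le {h : ℂ → ℂ} (hh : DifferentiableOn ℂ h (Metric.ball 0 1))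
    (hre : ∀ z ∈ Metric.ball (0 : ℂ) 1, 0 < (h z).re) {τ z w : ℂ} (hτ : ‖τ‖ = 1)
    (hz : z ∈ Metric.ball (0 : ℂ) 1) (hw : w ∈ Metric.ball (0 : ℂ) 1) (hzw : z ≠ w) :
    2 * inner ℝ ((τ + z) / (τ - z) - (τ + w) / (τ - w)) (h z - h w) /
        ‖(τ + z) / (τ - z) - (τ + w) / (τ - w)‖ ^ 2 ≤
      (h z).re / ((τ + z) / (τ - z)).re + (h w).re / ((τ + w) / (τ - w)).re := by
  have hz0 := sub_ne_zero_of_mem_ball hτ hz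
  have hw0 := sub_ne_zero_of_mem_ball hτ hw
  have hX := re_cayley_pos hτ hz
  have hY := re_cayley_pos hτ hw
  have eX := re_cayley_mul hτ hz0
  have eY := re_cayley_mul hτ hw0
  have e := norm_sq_cayley_sub_cayley_mul hτ hz0 hw0
  have hP := schwarzPick_rightHalfPlane hh hre hz hw
  have ha := hre z hz
  have hb := hre w hw
  set x := (τ + z) / (τ - z)
  set y := (τ + w) / (τ - w)
  have hT : 0 < ‖τ - z‖ ^ 2 * ‖τ - w‖ ^ 2 := by positivity
  have hE : 0 < ‖x - y‖ := by
    by_contra! h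
    rw [le_antisymm h (norm_nonneg _)] at e
    have : 0 < ‖z - w‖ := norm_pos_iff.2 (sub_ne_zero.2 hzw)
    nlinarith
  have h1 : ‖h z - h w‖ ^ 2 * (x.re * y.re) ≤ (h z).re * (h w).re * ‖x - y‖ ^ 2 := by
    refine le_of_mul_le_mul_right ?_ hT
    calc _ = ‖h z - h w‖ ^ 2 * ((1 - ‖z‖ ^ 2) * (1 - ‖w‖ ^ 2)) := by rw [← eX, ← eY]; ring
      _ ≤ _ := hP
      _ = (h z).re * (h w).re * (4 * ‖z - w‖ ^ 2) := by ring
      _ = _ := by rw [← e]; ring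
  have h2 : inner ℝ (x - y) (h z - h w) ≤ ‖x - y‖ * ‖h z - h w‖ := real_inner_le_norm _ _
  have h3 : 2 * inner ℝ (x - y) (h z - h w) / ‖x - y‖ ^ 2 ≤ 2 * (‖h z - h w‖ / ‖x - y‖) := by
    rw [div_le_iff₀ (by positivity)]
    have : 2 * (‖h z - h w‖ / ‖x - y‖) * ‖x - y‖ ^ 2 = 2 * (‖x - y‖ * ‖h z - h w‖) := by
      field_simp
    linarith
  refine h3.trans ?_
  set S := ‖h z - h w‖ / ‖x - y‖ with hS
  have h4 : S ^ 2 ≤ ((h z).re / x.re) * ((h w).re / y.re) := by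
    rw [hS, div_pow, div_mul_div_comm, div_le_div_iff₀ (by positivity) (by positivity)]
    exact h1
  have hA : 0 < (h z).re / x.re := div_pos ha hX
  have hB : 0 < (h w).re / y.re := div_pos hb hY
  refine le_of_sq_le_sq ?_ (by positivity)
  nlinarith [sq_nonneg ((h z).re / x.re - (h w).re / y.re)]

/-- In the half-plane coordinate the Berkson-Porta equation with boundary point `τ` becomes
`x' = 2 P`. -/
theorem hasDerivAt_cayley {φ : ℝ → ℂ} {P τ : ℂ} {t : ℝ} (hτ : ‖τ‖ = 1) (hne : τ - φ t ≠ 0)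
    (h : HasDerivAt φ ((φ t - τ) * (conj τ * φ t - 1) * P) t) :
    HasDerivAt (fun s => (τ + φ s) / (τ - φ s)) (2 * P) t := by
  have h1 := (h.const_add τ).fun_div (h.const_sub τ) hne
  convert! h1 using 1
  have h2 : conj τ * τ = 1 := by
    rw [← Complex.normSq_eq_conj_mul_self, Complex.normSq_eq_norm_sq, hτ]; simp
  rw [eq_div_iff (pow_ne_zero 2 hne)]
  linear_combination (-2 * (φ t - τ) * φ t * P) * h2

theorem LocallyAC.cayley {φ : ℝ → ℂ} {τ : ℂ} (hφ : LocallyAC φ)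
    (hne : ∀ t, 0 ≤ t → τ - φ t ≠ 0) : LocallyAC fun t => (τ + φ t) / (τ - φ t) := by
  refine hφ.comp_contDiffAt (Φ := fun z => (τ + z) / (τ - z)) fun t ht => ?_
  have h : ContDiffAt ℂ 1 (fun z => (τ + z) / (τ - z)) (φ t) :=
    (contDiffAt_const.add contDiffAt_id).div (contDiffAt_const.sub contDiffAt_id) (hne t ht)
  exact h.restrict_scalars ℝ

theorem HasDerivAt.complex_re {x : ℝ → ℂ} {x' : ℂ} {t : ℝ} (h : HasDerivAt x x' t) :
    HasDerivAt (fun s => (x s).re) x'.re t :=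
  Complex.reCLM.hasFDerivAt.comp_hasDerivAt t h

theorem re_le_add_mul {x P : ℝ → ℂ} {C₂ : ℝ} (hx : LocallyAC x)
    (hder : ∀ᵐ t : ℝ, 0 < t → HasDerivAt x (2 * P t) t)
    (hre : ∀ᵐ t : ℝ, 0 < t → (P t).re ≤ C₂) {t : ℝ} (ht : 0 ≤ t) :
    (x t).re ≤ (x 0).re + 2 * C₂ * t := by
  have hac : LocallyAC fun t => (x t).re - 2 * C₂ * t :=
    (hx.prodMk LocallyAC.id).comp_contDiffAt (Φ := fun v : ℂ × ℝ => v.1.re - 2 * C₂ * v.2)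
      fun t _ => (Complex.reCLM.contDiff.contDiffAt.comp _ contDiffAt_fst).sub
        (contDiffAt_const.mul contDiffAt_snd)
  have hanti := hac.antitoneOn (by
    filter_upwards [hder, hre] with s h1 h2 hs
    refine ⟨_, ?_, (h1 hs).complex_re.fun_sub ((hasDerivAt_id s).const_mul (2 * C₂))⟩
    have := h2 hs
    simp
    linarith)
  have := hanti (mem_Ici.2 le_rfl) (mem_Ici.2 ht) ht
  simp only [mul_zero, sub_zero] at this
  linarith

/-- With boundary Denjoy-Wolff point, two orbits approach each other in the hyperbolic metric. The
quantity in the limit is `ρ² / (1 - ρ²)`, with `ρ` the pseudo-hyperbolic distance. -/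
theorem tendsto_pseudohyperbolic_of_norm_eq_one {φ ψ : ℝ → ℂ} {p : ℂ → ℝ → ℂ} {τ : ℂ}
    {C₁ C₂ : ℝ} (hC₁ : 0 < C₁) (hC₂ : 0 < C₂) (hτ : ‖τ‖ = 1)
    (hφ : LocallyAC φ) (hφm : ∀ t, 0 ≤ t → φ t ∈ Metric.ball (0 : ℂ) 1)
    (hφd : ∀ᵐ t : ℝ, 0 < t →
      HasDerivAt φ ((φ t - τ) * (conj τ * φ t - 1) * p (φ t) t) t)
    (hψ : LocallyAC ψ) (hψm : ∀ t, 0 ≤ t → ψ t ∈ Metric.ball (0 : ℂ) 1)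
    (hψd : ∀ᵐ t : ℝ, 0 < t →
      HasDerivAt ψ ((ψ t - τ) * (conj τ * ψ t - 1) * p (ψ t) t) t)
    (hne : ∀ t, 0 ≤ t → φ t ≠ ψ t)
    (hp : ∀ t, 0 ≤ t → DifferentiableOn ℂ (fun z => p z t) (Metric.ball 0 1))
    (hre : ∀ᵐ t : ℝ, 0 ≤ t → ∀ z ∈ Metric.ball (0 : ℂ) 1, (p z t).re ∈ Icc C₁ C₂) :
    Tendsto (fun t => ‖φ t - ψ t‖ ^ 2 / ((1 - ‖φ t‖ ^ 2) * (1 - ‖ψ t‖ ^ 2))) atTop (𝓝 0) := by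
  have hφ0 : ∀ t, 0 ≤ t → τ - φ t ≠ 0 := fun t ht => sub_ne_zero_of_mem_ball hτ (hφm t ht)
  have hψ0 : ∀ t, 0 ≤ t → τ - ψ t ≠ 0 := fun t ht => sub_ne_zero_of_mem_ball hτ (hψm t ht)
  obtain ⟨x, hx⟩ : ∃ x : ℝ → ℂ, x = fun t => (τ + φ t) / (τ - φ t) := ⟨_, rfl⟩
  obtain ⟨y, hy⟩ : ∃ y : ℝ → ℂ, y = fun t => (τ + ψ t) / (τ - ψ t) := ⟨_, rfl⟩
  have hxac : LocallyAC x := hx ▸ hφ.cayley hφ0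
  have hyac : LocallyAC y := hy ▸ hψ.cayley hψ0
  have hxpos : ∀ t, 0 ≤ t → 0 < (x t).re := fun t ht => by
    rw [hx]; exact re_cayley_pos hτ (hφm t ht)
  have hypos : ∀ t, 0 ≤ t → 0 < (y t).re := fun t ht => by
    rw [hy]; exact re_cayley_pos hτ (hψm t ht)
  have hxd : ∀ᵐ t : ℝ, 0 < t → HasDerivAt x (2 * p (φ t) t) t := by
    filter_upwards [hφd] with t h ht
    rw [hx]
    exact hasDerivAt_cayley hτ (hφ0 t ht.le) (h ht)
  have hyd : ∀ᵐ t : ℝ, 0 < t → HasDerivAt y (2 * p (ψ t) t) t := by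
    filter_upwards [hψd] with t h ht
    rw [hy]
    exact hasDerivAt_cayley hτ (hψ0 t ht.le) (h ht)
  have hratio : ∀ t, 0 ≤ t → ‖x t - y t‖ ^ 2 / ((x t).re * (y t).re) =
      4 * (‖φ t - ψ t‖ ^ 2 / ((1 - ‖φ t‖ ^ 2) * (1 - ‖ψ t‖ ^ 2))) := by
    intro t ht
    have e := norm_sq_cayley_sub_cayley_mul hτ (hφ0 t ht) (hψ0 t ht)
    have e1 := re_cayley_mul hτ (hφ0 t ht)
    have e2 := re_cayley_mul hτ (hψ0 t ht)
    have h1 := hφ0 t ht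
    have h2 := hψ0 t ht
    rw [← mul_div_assoc, ← e, ← e1, ← e2, hx, hy]
    have h3 : ‖τ - φ t‖ ^ 2 * ‖τ - ψ t‖ ^ 2 ≠ 0 := by positivity
    rw [mul_mul_mul_comm, mul_div_mul_right _ _ h3]
  have hxy : ∀ t, 0 ≤ t → x t - y t ≠ 0 := by
    intro t ht h0
    have e := norm_sq_cayley_sub_cayley_mul hτ (hφ0 t ht) (hψ0 t ht)
    rw [hx, hy] at h0
    rw [h0, norm_zero] at e
    have : 0 < ‖φ t - ψ t‖ := norm_pos_iff.2 (sub_ne_zero.2 (hne t ht))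
    nlinarith
  obtain ⟨q, hq⟩ : ∃ q, q = (x 0).re := ⟨_, rfl⟩
  have hq0 : 0 < q := hq ▸ hxpos 0 le_rfl
  have hqt : ∀ t, 0 ≤ t → 0 < q + 2 * C₂ * t := fun t ht => by positivity
  have hgrow : ∀ t, 0 ≤ t → (x t).re ≤ q + 2 * C₂ * t := fun t ht => by
    rw [hq]
    refine re_le_add_mul hxac hxd ?_ ht
    filter_upwards [hre] with s hs hs0
    exact (hs hs0.le _ (hφm s hs0.le)).2
  -- This `α` makes the derivative of `α * log (q + 2 C₂ t)` equal to `C₁ / (q + 2 C₂ t)`.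
  obtain ⟨α, hα⟩ : ∃ α, α = C₁ / (2 * C₂) := ⟨_, rfl⟩
  have hα0 : 0 < α := by rw [hα]; positivity
  set L : ℝ → ℝ := fun t => Real.log (‖x t - y t‖ ^ 2) - Real.log (x t).re - Real.log (y t).re +
    α * Real.log (q + 2 * C₂ * t) with hL
  have hLac : LocallyAC L := by
    refine (hxac.prodMk (hyac.prodMk LocallyAC.id)).comp_contDiffAt
      (Φ := fun v : ℂ × ℂ × ℝ => Real.log (‖v.1 - v.2.1‖ ^ 2) - Real.log v.1.re -
        Real.log v.2.1.re + α * Real.log (q + 2 * C₂ * v.2.2)) fun t ht => ?_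
    have c2 : ContDiffAt ℝ 1 (fun v : ℂ × ℂ × ℝ => v.2.1) (x t, y t, t) :=
      contDiff_fst.contDiffAt.comp _ contDiffAt_snd
    have c3 : ContDiffAt ℝ 1 (fun v : ℂ × ℂ × ℝ => v.2.2) (x t, y t, t) :=
      contDiff_snd.contDiffAt.comp _ contDiffAt_snd
    have h0 := hxy t ht
    have h1 := hxpos t ht
    have h2 := hypos t ht
    have h3 := hqt t ht
    refine (((((contDiffAt_fst.sub c2).norm_sq ℝ).log ?_).sub
      ((Complex.reCLM.contDiff.contDiffAt.comp _ contDiffAt_fst).log ?_)).sub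
      ((Complex.reCLM.contDiff.contDiffAt.comp _ c2).log ?_)).add
      (contDiffAt_const.mul ((contDiffAt_const.add (contDiffAt_const.mul c3)).log ?_))
    · positivity
    · exact h1.ne'
    · exact h2.ne'
    · exact h3.ne'
  have hanti : AntitoneOn L (Ici 0) := by
    refine hLac.antitoneOn ?_
    filter_upwards [hxd, hyd, hre] with t hxt hyt hpt ht
    have h0 := hxy t ht.le
    have h1 := hxpos t ht.le
    have h2 := hypos t ht.le
    have h3 := hqt t ht.le
    have hsq : ‖x t - y t‖ ^ 2 ≠ 0 := by positivity
    have d1 := (((hxt ht).fun_sub (hyt ht)).norm_sq.log hsq)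
    have d2 := (hxt ht).complex_re.log h1.ne'
    have d3 := (hyt ht).complex_re.log h2.ne'
    have d4 := ((((hasDerivAt_id t).const_mul (2 * C₂)).const_add q).log h3.ne').const_mul α
    refine ⟨_, ?_, ((d1.fun_sub d2).fun_sub d3).fun_add d4⟩
    -- Half of `C₁` is subtracted, not all of it, to keep the real part strictly positive.
    have hest := inner_cayley_sub_cayley_le (h := fun z => p z t - ((C₁ / 2 : ℝ) : ℂ))
      ((hp t ht.le).sub_const _) (fun z hz => by
        have := (hpt ht.le z hz).1
        rw [Complex.sub_re, Complex.ofReal_re]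
        linarith) hτ (hφm t ht.le) (hψm t ht.le) (hne t ht.le)
    have ex : (τ + φ t) / (τ - φ t) = x t := by rw [hx]
    have ey : (τ + ψ t) / (τ - ψ t) = y t := by rw [hy]
    simp only [ex, ey, sub_sub_sub_cancel_right, Complex.sub_re, Complex.ofReal_re] at hest
    have e2 : ∀ P : ℂ, (2 * P).re = 2 * P.re := fun P => by simp
    have e1 : 2 * inner ℝ (x t - y t) (2 * p (φ t) t - 2 * p (ψ t) t) / ‖x t - y t‖ ^ 2 =
        2 * (2 * inner ℝ (x t - y t) (p (φ t) t - p (ψ t) t) / ‖x t - y t‖ ^ 2) := by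
      rw [← mul_sub, Complex.inner, Complex.inner, mul_assoc, e2]
      ring
    have e3 : α * (2 * C₂ * 1 / (q + 2 * C₂ * id t)) ≤ C₁ / (x t).re := by
      have : α * (2 * C₂ * 1 / (q + 2 * C₂ * id t)) = C₁ / (q + 2 * C₂ * t) := by
        rw [hα, id]; field_simp
      rw [this]
      exact div_le_div_of_nonneg_left hC₁.le h1 (hgrow t ht.le)
    have e4 : 0 < C₁ / (y t).re := div_pos hC₁ h2
    rw [e1, e2, e2]
    have e5 : ∀ a X : ℝ, (a - C₁ / 2) / X = a / X - C₁ / X / 2 := fun a X => by ring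
    have e6 : ∀ a X : ℝ, 2 * a / X = 2 * (a / X) := fun a X => by ring
    rw [e5, e5] at hest
    rw [e6 (p (φ t) t).re, e6 (p (ψ t) t).re]
    linarith
  have hlim : Tendsto (fun t : ℝ => Real.exp (L 0 - α * Real.log (q + 2 * C₂ * t)) / 4)
      atTop (𝓝 0) := by
    have h1 : Tendsto (fun t : ℝ => q + 2 * C₂ * t) atTop atTop :=
      tendsto_atTop_add_const_left _ _ (tendsto_id.const_mul_atTop (by positivity))
    have h2 : Tendsto (fun t : ℝ => L 0 - α * Real.log (q + 2 * C₂ * t)) atTop atBot :=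
      tendsto_atBot_add_const_left _ (L 0) (tendsto_neg_atTop_atBot.comp
        ((Real.tendsto_log_atTop.comp h1).const_mul_atTop hα0))
    simpa using (Real.tendsto_exp_atBot.comp h2).div_const 4
  have hN : ∀ t, 0 ≤ t →
      ‖φ t - ψ t‖ ^ 2 / ((1 - ‖φ t‖ ^ 2) * (1 - ‖ψ t‖ ^ 2)) =
      ‖x t - y t‖ ^ 2 / ((x t).re * (y t).re) / 4 := fun t ht => by
    rw [hratio t ht]; ring
  refine squeeze_zero' ?_ ?_ hlim
  · filter_upwards [eventually_ge_atTop 0] with t ht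
    have h1 := hxpos t ht
    have h2 := hypos t ht
    rw [hN t ht]
    positivity
  · filter_upwards [eventually_ge_atTop 0] with t ht
    have h1 := hxpos t ht
    have h2 := hypos t ht
    have h0 := hxy t ht
    rw [hN t ht]
    have hle : L t ≤ L 0 := hanti (mem_Ici.2 le_rfl) (mem_Ici.2 ht) ht
    have hlog : Real.log (‖x t - y t‖ ^ 2 / ((x t).re * (y t).re)) =
        L t - α * Real.log (q + 2 * C₂ * t) := by
      rw [Real.log_div (by positivity) (by positivity), Real.log_mul h1.ne' h2.ne', hL]
      ring
    have hpos : 0 < ‖x t - y t‖ ^ 2 / ((x t).re * (y t).re) := by positivity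
    rw [← Real.exp_log hpos, hlog]
    gcongr

/-! ### The Loewner range -/

theorem lemma4p3 (f : ℝ → ℂ → ℂ) (p : ℂ → ℝ → ℂ) (τ : ℝ → ℂ)
    (hf : IsLoewnerChain f) (hp : IsBerksonPortaData f p τ)
    (hτ : ∃ τ₀ ∈ Metric.closedBall (0 : ℂ) 1, ∀ t : ℝ, 0 ≤ t → τ t = τ₀)
    (C₁ C₂ : ℝ) (hC₁ : 0 < C₁) (hC₂ : 0 < C₂)
    (hbound : ∀ z ∈ Metric.ball (0 : ℂ) 1, ∀ᵐ t : ℝ, 0 ≤ t →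
      C₁ < (p z t).re ∧ (p z t).re < C₂) :
    loewnerRange f = univ := by
  obtain ⟨τ₀, hτ₀, hconst⟩ := hτ
  have hre := ae_forall_re_mem_Icc Metric.isOpen_ball
    (fun t ht => (hp.herglotz.holomorphic t ht).continuousOn) hbound
  by_contra hrange
  obtain ⟨w₀, hw₀⟩ := (ne_univ_iff_exists_notMem _).1 hrange
  have homit : ∀ t, 0 ≤ t → ∀ z ∈ Metric.ball (0 : ℂ) 1, f t z ≠ w₀ := by
    intro t ht z hz h
    exact hw₀ (mem_biUnion (mem_Ici.2 ht) ⟨z, hz, h⟩)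
  obtain ⟨a, b, ha, hb, hab⟩ : ∃ a b : ℂ, a ∈ Metric.ball (0 : ℂ) 1 ∧
      b ∈ Metric.ball (0 : ℂ) 1 ∧ a ≠ b :=
    ⟨0, 1 / 2, by simp, by rw [mem_ball_zero_iff]; norm_num, by norm_num⟩
  have hode : ∀ z ∈ Metric.ball (0 : ℂ) 1, ∀ᵐ t : ℝ, 0 < t →
      HasDerivAt (fun t => transitionMap f 0 t z) ((transitionMap f 0 t z - τ₀) *
        (conj τ₀ * transitionMap f 0 t z - 1) * p (transitionMap f 0 t z) t) t := by
    intro z hz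
    filter_upwards [hp.ode 0 le_rfl z hz] with t h ht
    have := h ht
    rwa [hconst t ht.le] at this
  have hmem : ∀ z ∈ Metric.ball (0 : ℂ) 1, ∀ t, 0 ≤ t →
      transitionMap f 0 t z ∈ Metric.ball (0 : ℂ) 1 :=
    fun z hz t ht => hf.transitionMap_mem le_rfl ht hz
  have hlim : Tendsto (fun t => ‖transitionMap f 0 t a - transitionMap f 0 t b‖ ^ 2 /
      ((1 - ‖transitionMap f 0 t a‖ ^ 2) * (1 - ‖transitionMap f 0 t b‖ ^ 2))) atTop (𝓝 0) := by
    rcases (mem_closedBall_zero_iff.1 hτ₀).lt_or_eq with h1 | h1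
    · have htend : ∀ z ∈ Metric.ball (0 : ℂ) 1,
          Tendsto (fun t => transitionMap f 0 t z) atTop (𝓝 τ₀) := fun z hz =>
        tendsto_denjoyWolff_of_norm_lt_one hC₁ h1 (hf.locallyAC_transitionMap hz) (hmem z hz) (hode z hz) (by
          filter_upwards [hre] with t h ht
          exact (h ht.le _ (hmem z hz t ht.le)).1)
      have hA := htend a ha
      have hB := htend b hb
      have h2 : (1 - ‖τ₀‖ ^ 2) * (1 - ‖τ₀‖ ^ 2) ≠ 0 := by
        have : 0 < 1 - ‖τ₀‖ ^ 2 := by nlinarith [norm_nonneg τ₀]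
        positivity
      have := ((hA.sub hB).norm.pow 2).div
        (((hA.norm.pow 2).const_sub 1).mul ((hB.norm.pow 2).const_sub 1)) h2
      rw [sub_self, norm_zero, zero_pow two_ne_zero, zero_div] at this
      exact this
    · refine tendsto_pseudohyperbolic_of_norm_eq_one hC₁ hC₂ h1
        (hf.locallyAC_transitionMap ha) (hmem a ha) (hode a ha)
        (hf.locallyAC_transitionMap hb) (hmem b hb) (hode b hb) (fun t ht h => hab ?_)
        hp.herglotz.holomorphic hre
      have h2 := hf.apply_transitionMap le_rfl ht ha
      rw [h, hf.apply_transitionMap le_rfl ht hb] at h2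
      exact (hf.injective 0 le_rfl hb ha h2).symm
  -- Precompose `f t` with the disk automorphism moving `0` to `φ_{0,t}(a)`.
  have hexp : ∀ t, 0 ≤ t → ∃ u : ℂ, ‖u‖ < 1 ∧
      ‖u‖ ^ 2 ≤ ‖transitionMap f 0 t a - transitionMap f 0 t b‖ ^ 2 /
        ((1 - ‖transitionMap f 0 t a‖ ^ 2) * (1 - ‖transitionMap f 0 t b‖ ^ 2)) ∧
      (‖u‖ < 1 / 2 → ∃ v : ℂ, ‖v‖ ≤ 768 * ‖u‖ ∧
        f 0 b - w₀ = (f 0 a - w₀) * Complex.exp v) := by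
    intro t ht
    have hat := hmem a ha t ht
    have hbt := hmem b hb t ht
    obtain ⟨n, u, hn, hmaps, hinj, hn0, hnu, hu1, hu⟩ := exists_diskAutomorphism hat hbt
    refine ⟨u, mem_ball_zero_iff.1 hu1, ?_, fun hu2 => ?_⟩
    · rw [mem_ball_zero_iff] at hat hbt
      have h1 : 0 < 1 - ‖transitionMap f 0 t a‖ ^ 2 := by
        nlinarith [norm_nonneg (transitionMap f 0 t a)]
      have h2 : 0 < 1 - ‖transitionMap f 0 t b‖ ^ 2 := by
        nlinarith [norm_nonneg (transitionMap f 0 t b)]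
      rw [le_div_iff₀ (mul_pos h1 h2), norm_sub_rev]
      nlinarith [mul_nonneg (sq_nonneg ‖u‖)
        (sq_nonneg ‖transitionMap f 0 t b - transitionMap f 0 t a‖)]
    · obtain ⟨v, hv, he⟩ := exists_sub_eq_mul_exp_of_omits (g := f t ∘ n)
        ((hf.holomorphic t ht).comp hn hmaps) ((hf.injective t ht).comp hinj hmaps)
        (fun z hz => homit t ht _ (hmaps hz)) hu2
      refine ⟨v, hv, ?_⟩
      rwa [Function.comp_apply, Function.comp_apply, hn0, hnu,
        hf.apply_transitionMap le_rfl ht ha, hf.apply_transitionMap le_rfl ht hb] at he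
  choose! u hu1 hu2 hu3 using hexp
  have hu : Tendsto (fun t => ‖u t‖) atTop (𝓝 0) := by
    have h1 := hlim.sqrt
    rw [Real.sqrt_zero] at h1
    refine squeeze_zero' (Eventually.of_forall fun t => norm_nonneg _) ?_ h1
    filter_upwards [eventually_ge_atTop 0] with t ht using Real.le_sqrt_of_sq_le (hu2 t ht)
  have hev : ∀ᶠ t in atTop, ∃ v : ℂ, ‖v‖ ≤ 768 * ‖u t‖ ∧
      f 0 b - w₀ = (f 0 a - w₀) * Complex.exp v := by
    filter_upwards [eventually_ge_atTop 0, hu.eventually (gt_mem_nhds (by norm_num : (0 : ℝ) < 1 / 2))]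
      with t ht h using hu3 t ht h
  obtain ⟨T, hT⟩ := eventually_atTop.1 hev
  choose! v hv1 hv2 using hT
  have hv : Tendsto v atTop (𝓝 0) := by
    rw [tendsto_zero_iff_norm_tendsto_zero]
    have h1 := hu.const_mul 768
    rw [mul_zero] at h1
    refine squeeze_zero' (Eventually.of_forall fun t => norm_nonneg _) ?_ h1
    filter_upwards [eventually_ge_atTop T] with t ht using hv1 t ht
  have hconv : Tendsto (fun t => (f 0 a - w₀) * Complex.exp (v t)) atTop (𝓝 (f 0 a - w₀)) := by
    simpa using (hv.cexp).const_mul (f 0 a - w₀)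
  have heq : f 0 b - w₀ = f 0 a - w₀ := by
    refine tendsto_nhds_unique (tendsto_const_nhds.congr' ?_) hconv
    filter_upwards [eventually_ge_atTop T] with t ht using hv2 t ht
  exact hab (hf.injective 0 le_rfl ha hb (sub_left_inj.1 heq).symm)
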